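/- Let $A$ be a $C^*$-algebra (not necessarily unital) and let $X$, $Y$ be Hilbert $A$-modules, with $A$-valued inner products that are $A$-linear in the second variable. (We let $A$ act on the left; right modules are covered by passing to the opposite $C^*$-algebra.) An operator $t$ between $X$ and $Y$ is an $A$-linear map from a submodule $\mathrm{Dom}(t)\subseteq X$ to $Y$. If $t$ is densely defined, its adjoint $t^*$ has domain $$\mathrm{Dom}(t^*)=\{y\in Y:\ \exists z\in X\ \forall x\in \mathrm{Dom}(t),\ \langle t(x),y\rangle=\langle x,z\rangle\},$$ and $t^*(y)=z$ for this (unique) $z$. For operators $s,t$, the composition $ts$ has domain $\{x\in\mathrm{Dom}(s): s(x)\in \mathrm{Dom}(t)\}$. Call $t$ regular if it is densely defined and closed (its graph is closed in $X\oplus Y$), $\mathrm{Dom}(t^*)$ is dense in $Y$, and the range of $1+t^*t$ is dense in $X$. Let $t$ be a regular operator between $X$ and $Y$ whose range $\mathrm{Ran}(t)$ is closed in $Y$. Then $\mathrm{Ran}(tt^*)$ is closed in $Y$; in fact $\mathrm{Ran}(tt^*)=\mathrm{Ran}(t)$. -/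

import Mathlib

/-!
Hilbert `A`-modules are Mathlib's `CStarModule A X` with `X` complete; `A` is an arbitrary, possibly
non-unital, C⋆-algebra. The inner product is linear in the second variable. Mathlib writes the
action of `A` as `a • x`; a right Hilbert module over a C⋆-algebra is the same thing as
a `CStarModule` over the opposite C⋆-algebra.

A (possibly unbounded) operator between `X` and `Y` is a partially defined `ℂ`-linear map
`t : X →ₗ.[ℂ] Y`.
-/

namespace HilbertModule

section Algebraic

variable {X Y Z : Type*} [AddCommGroup X] [Module ℂ X] [AddCommGroup Y] [Module ℂ Y]
  [AddCommGroup Z] [Module ℂ Z]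

/-- `t` is `A`-linear: its domain is stable under the action of `A`, and `t` commutes with it. -/
def IsALinear (A : Type*) [SMul A X] [SMul A Y] (t : X →ₗ.[ℂ] Y) : Prop :=
  ∀ (a : A) (x : t.domain), ∃ h : a • (x : X) ∈ t.domain, t ⟨a • (x : X), h⟩ = a • t x

/-- The composition `t s` of two partially defined operators, with domain
`{x ∈ Dom s | s x ∈ Dom t}`. -/
def comp (t : Y →ₗ.[ℂ] Z) (s : X →ₗ.[ℂ] Y) : X →ₗ.[ℂ] Z where
  domain :=
    { carrier := {x | ∃ h : x ∈ s.domain, s ⟨x, h⟩ ∈ t.domain}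
      add_mem' := by
        rintro x y ⟨hx, hx'⟩ ⟨hy, hy'⟩
        refine ⟨s.domain.add_mem hx hy, ?_⟩
        have h := s.map_add ⟨x, hx⟩ ⟨y, hy⟩
        exact h ▸ t.domain.add_mem hx' hy'
      zero_mem' := ⟨s.domain.zero_mem, by
        have h := s.map_zero
        exact h ▸ t.domain.zero_mem⟩
      smul_mem' := by
        rintro c x ⟨hx, hx'⟩
        refine ⟨s.domain.smul_mem c hx, ?_⟩
        have h := s.map_smul c ⟨x, hx⟩
        exact h ▸ t.domain.smul_mem c hx' }
  toFun :=
    { toFun := fun x => t ⟨s ⟨x, x.2.1⟩, x.2.2⟩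
      map_add' := fun x y => by
        rw [← t.map_add]
        congr 1
        exact Subtype.ext (s.map_add ⟨x, x.2.1⟩ ⟨y, y.2.1⟩)
      map_smul' := fun c x => by
        rw [RingHom.id_apply, ← t.map_smul]
        congr 1
        exact Subtype.ext (s.map_smul c ⟨x, x.2.1⟩) }

end Algebraic

section Hilbert

variable (A : Type*) {X Y : Type*} [NonUnitalCStarAlgebra A] [PartialOrder A] [StarOrderedRing A]
  [NormedAddCommGroup X] [NormedSpace ℂ X] [SMul A X] [CStarModule A X]
  [NormedAddCommGroup Y] [NormedSpace ℂ Y] [SMul A Y] [CStarModule A Y]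

/-- The set of all pairs `(y, z)` such that `⟪t x, y⟫ = ⟪x, z⟫` for all `x ∈ Dom t`. -/
def adjointGraph (t : X →ₗ.[ℂ] Y) : Submodule ℂ (Y × X) where
  carrier := {p | ∀ x : t.domain, inner A (t x) p.1 = inner A (x : X) p.2}
  add_mem' := by
    intro p q hp hq x
    simp [hp x, hq x]
  zero_mem' := by
    intro x
    simp
  smul_mem' := by
    intro c p hp x
    simp [hp x]

/-- The adjoint `t*`. Its domain is the set of all `y` for which some `z` satisfies
`⟪t x, y⟫ = ⟪x, z⟫` for all `x ∈ Dom t`, and `t* y = z`. The value is meaningful when `t` is densely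
defined, since then `z` is unique. -/
noncomputable def adjoint (t : X →ₗ.[ℂ] Y) : Y →ₗ.[ℂ] X :=
  (adjointGraph A t).toLinearPMap

theorem mem_adjoint_domain (t : X →ₗ.[ℂ] Y) (y : Y) :
    y ∈ (adjoint A t).domain ↔ ∃ z : X, ∀ x : t.domain, inner A (t x) y = inner A (x : X) z := by
  rw [adjoint, Submodule.toLinearPMap_domain, Submodule.mem_map]
  constructor
  · rintro ⟨p, hp, rfl⟩
    exact ⟨p.2, hp⟩
  · rintro ⟨z, hz⟩
    exact ⟨(y, z), hz, rfl⟩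

/-- The defining property of the adjoint of a densely defined operator. -/
theorem inner_adjoint {t : X →ₗ.[ℂ] Y} (ht : Dense (t.domain : Set X)) (x : t.domain)
    (y : (adjoint A t).domain) : inner A (t x) (y : Y) = inner A (x : X) (adjoint A t y) := by
  refine Submodule.mem_graph_toLinearPMap (g := adjointGraph A t) ?_ y x
  rintro ⟨y, z⟩ h rfl
  have hz : ∀ x ∈ (t.domain : Set X), inner A x z = (0 : A) := fun x hx => by
    rw [← h ⟨x, hx⟩, CStarModule.inner_zero_right]
  have hc : Continuous fun x : X => (inner A x z : A) :=
    CStarModule.continuous_inner.comp (by fun_prop : Continuous fun x : X => (x, z))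
  have := hc.ext_on ht continuous_const hz
  exact CStarModule.inner_self.1 (congrFun this z)

/-- `t` is a regular operator: it is `A`-linear, densely defined, closed, adjointable (its adjoint
is densely defined), and `1 + t* t` has dense range. -/
structure IsRegular (t : X →ₗ.[ℂ] Y) : Prop where
  isALinear : IsALinear A t
  dense_domain : Dense (t.domain : Set X)
  isClosed : t.IsClosed
  dense_adjoint_domain : Dense ((adjoint A t).domain : Set Y)
  dense_range_one_add : Dense
    (Set.range fun x : (comp (adjoint A t) t).domain => (x : X) + comp (adjoint A t) t x)

end Hilbert

end HilbertModule

namespace HilbertModule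

section Hilbert

open Filter Topology

variable {A : Type*} {X Y : Type*} [NonUnitalCStarAlgebra A] [PartialOrder A] [StarOrderedRing A]
  [NormedAddCommGroup X] [NormedSpace ℂ X] [SMul A X] [CStarModule A X]
  [NormedAddCommGroup Y] [NormedSpace ℂ Y] [SMul A Y] [CStarModule A Y]

/-! Regularize `t t* v = y` by `(c + t t*) v = y` and let `c` tend to 0. For `y = t x` the solution
is `v = t u` with `(c + t* t) u = x`, so regularity of `t` suffices, and `v` lies in `Ran t`. Closed
range gives, by the open mapping theorem, `‖w‖ ≤ C ‖t* w‖` for `w ∈ Ran t ∩ Dom t*`. Hence `v` and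
`z = t* v` stay bounded as `c = 2⁻ⁿ` shrinks, their increments are `O(2⁻ⁿ)`, and closedness of `t`
and `t*` turns the limits into `t t* v₀ = y`. No orthogonal complement of the range is used. -/

/-! ### Graphs and inner product estimates. -/

theorem inner_of_mem_graph {t : X →ₗ.[ℂ] Y} {x : X} {y w : Y} {z : X}
    (hxy : (x, y) ∈ t.graph) (hwz : (w, z) ∈ adjointGraph A t) :
    inner A y w = inner A x z := by
  obtain ⟨x', rfl, rfl⟩ := (LinearPMap.mem_graph_iff t).1 hxy
  exact hwz x'

theorem graph_adjoint {t : X →ₗ.[ℂ] Y} (ht : Dense (t.domain : Set X)) :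
    (adjoint A t).graph = adjointGraph A t := by
  refine Submodule.toLinearPMap_graph_eq _ ?_
  rintro ⟨y, z⟩ h rfl
  have hz : ∀ x ∈ (t.domain : Set X), inner A x z = (0 : A) := fun x hx => by
    rw [← h ⟨x, hx⟩, CStarModule.inner_zero_right]
  have hc : Continuous fun x : X => (inner A x z : A) :=
    CStarModule.continuous_inner.comp (by fun_prop : Continuous fun x : X => (x, z))
  exact CStarModule.inner_self.1 (congrFun (hc.ext_on ht continuous_const hz) z)

theorem isClosed_adjointGraph (t : X →ₗ.[ℂ] Y) :
    IsClosed (adjointGraph A t : Set (Y × X)) := by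
  have h : (adjointGraph A t : Set (Y × X)) =
      ⋂ x : t.domain, {p | inner A (t x) p.1 = inner A (x : X) p.2} := by
    ext p
    simp [adjointGraph]
  rw [h]
  refine isClosed_iInter fun x => isClosed_eq ?_ ?_
  · exact CStarModule.continuous_inner.comp
      (by fun_prop : Continuous fun p : Y × X => (t x, p.1))
  · exact CStarModule.continuous_inner.comp
      (by fun_prop : Continuous fun p : Y × X => ((x : X), p.2))

theorem mem_graph_comp {Z : Type*} [AddCommGroup Z] [Module ℂ Z] {s : X →ₗ.[ℂ] Y}
    {t : Y →ₗ.[ℂ] Z} {x : X} {z : Z} :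
    (x, z) ∈ (comp t s).graph ↔ ∃ y, (x, y) ∈ s.graph ∧ (y, z) ∈ t.graph := by
  constructor
  · intro h
    obtain ⟨x', rfl, rfl⟩ := (LinearPMap.mem_graph_iff _).1 h
    exact ⟨s ⟨x', x'.2.1⟩, LinearPMap.mem_graph s ⟨x', x'.2.1⟩, LinearPMap.mem_graph t ⟨_, x'.2.2⟩⟩
  · rintro ⟨y, h, h'⟩
    obtain ⟨x', rfl, rfl⟩ := (LinearPMap.mem_graph_iff _).1 h
    obtain ⟨y', hy, rfl⟩ := (LinearPMap.mem_graph_iff _).1 h'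
    obtain ⟨y', hy'⟩ := y'
    obtain rfl : y' = s x' := hy
    exact LinearPMap.mem_graph (comp t s) ⟨x', x'.2, hy'⟩

/-- A sum of inner squares dominates each of them, and is bounded by Cauchy-Schwarz. -/
theorem sq_norm_le_of_inner_eq {c : ℝ} (hc : 0 ≤ c) {a b : X} {v : Y}
    (h : inner A a b = (c : ℂ) • inner A a a + (inner A v v : A)) :
    c * ‖a‖ ^ 2 ≤ ‖a‖ * ‖b‖ ∧ ‖v‖ ^ 2 ≤ ‖a‖ * ‖b‖ := by
  have hs : (0 : A) ≤ (c : ℂ) • inner A a a := by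
    have := smul_nonneg hc (CStarModule.inner_self_nonneg (A := A) (x := a))
    rwa [← Complex.coe_smul] at this
  have hv : (0 : A) ≤ inner A v v := CStarModule.inner_self_nonneg
  have hle : ‖(inner A a b : A)‖ ≤ ‖a‖ * ‖b‖ := CStarModule.norm_inner_le X
  refine ⟨le_trans ?_ hle, le_trans ?_ hle⟩
  · have : c * ‖a‖ ^ 2 = ‖(c : ℂ) • (inner A a a : A)‖ := by
      rw [norm_smul, CStarModule.norm_sq_eq A, Complex.norm_real, Real.norm_of_nonneg hc]
    rw [this, h]
    exact CStarAlgebra.norm_le_norm_of_nonneg_of_le hs (le_add_of_nonneg_right hv)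
  · rw [CStarModule.norm_sq_eq A, h]
    exact CStarAlgebra.norm_le_norm_of_nonneg_of_le hv (le_add_of_nonneg_left hs)

/-! ### Solving `(c + t* t) u = x` for `c = 2⁻ⁿ`. -/

variable (A) in
/-- `u` solves `(c + t* t) u = x`, and `v = t u`. -/
def IsResolvent (t : X →ₗ.[ℂ] Y) (c : ℝ) (x u : X) (v : Y) : Prop :=
  (u, v) ∈ t.graph ∧ (v, x - (c : ℂ) • u) ∈ adjointGraph A t

namespace IsResolvent

variable {t : X →ₗ.[ℂ] Y} {c : ℝ} {x x' u u' : X} {v v' : Y}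

theorem sub (h : IsResolvent A t c x u v) (h' : IsResolvent A t c x' u' v') :
    IsResolvent A t c (x - x') (u - u') (v - v') := by
  refine ⟨t.graph.sub_mem h.1 h'.1, ?_⟩
  have := (adjointGraph A t).sub_mem h.2 h'.2
  rwa [Prod.mk_sub_mk, sub_sub_sub_comm, ← smul_sub] at this

theorem norm_bounds (h : IsResolvent A t c x u v) (hc : 0 ≤ c) :
    c * ‖u‖ ^ 2 ≤ ‖u‖ * ‖x‖ ∧ ‖v‖ ^ 2 ≤ ‖u‖ * ‖x‖ := by
  refine sq_norm_le_of_inner_eq (A := A) hc ?_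
  rw [inner_of_mem_graph h.1 h.2]
  simp

theorem mul_norm_le (h : IsResolvent A t c x u v) (hc : 0 ≤ c) : c * ‖u‖ ≤ ‖x‖ := by
  rcases eq_or_ne u 0 with rfl | hu
  · simp
  · have := (h.norm_bounds hc).1
    have hu' := norm_pos_iff.2 hu
    nlinarith

/-- At `c = 1` the a priori bounds give `‖u‖, ‖v‖ ≤ ‖x‖`, so solutions for data converging to `x`
are Cauchy, and both graphs are closed. -/
theorem exists_one [CompleteSpace X] [CompleteSpace Y] (ht : t.IsClosed)
    (hd : Dense (t.domain : Set X))
    (hr : Dense (Set.range fun x : (comp (adjoint A t) t).domain =>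
      (x : X) + comp (adjoint A t) t x)) (x : X) : ∃ u v, IsResolvent A t 1 x u v := by
  obtain ⟨f, hf, hfx⟩ := mem_closure_iff_seq_limit.1 (hr x)
  have hex : ∀ n, ∃ u v, IsResolvent A t 1 (f n) u v := by
    intro n
    obtain ⟨u, hu⟩ := hf n
    obtain ⟨v, hv, hv'⟩ := mem_graph_comp.1 (LinearPMap.mem_graph (comp (adjoint A t) t) u)
    rw [graph_adjoint hd] at hv'
    refine ⟨u, v, hv, ?_⟩
    simpa [← hu] using hv'
  choose u v h using hex
  have hu : ∀ m n, dist (u m) (u n) ≤ dist (f m) (f n) := by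
    intro m n
    have := ((h m).sub (h n)).mul_norm_le zero_le_one
    simpa [dist_eq_norm] using this
  have hv : ∀ m n, dist (v m) (v n) ≤ dist (f m) (f n) := by
    intro m n
    have h1 := ((h m).sub (h n)).mul_norm_le zero_le_one
    have h2 := (((h m).sub (h n)).norm_bounds zero_le_one).2
    rw [dist_eq_norm, dist_eq_norm]
    refine le_of_sq_le_sq ?_ (norm_nonneg _)
    nlinarith [norm_nonneg (f m - f n)]
  have hcf := hfx.cauchySeq
  have hcu : CauchySeq u := by
    rw [Metric.cauchySeq_iff] at hcf ⊢
    intro ε hε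
    obtain ⟨N, hN⟩ := hcf ε hε
    exact ⟨N, fun m hm n hn => (hu m n).trans_lt (hN m hm n hn)⟩
  have hcv : CauchySeq v := by
    rw [Metric.cauchySeq_iff] at hcf ⊢
    intro ε hε
    obtain ⟨N, hN⟩ := hcf ε hε
    exact ⟨N, fun m hm n hn => (hv m n).trans_lt (hN m hm n hn)⟩
  obtain ⟨u₀, hu₀⟩ := cauchySeq_tendsto_of_complete hcu
  obtain ⟨v₀, hv₀⟩ := cauchySeq_tendsto_of_complete hcv
  refine ⟨u₀, v₀, ?_, ?_⟩
  · exact ht.mem_of_tendsto (hu₀.prodMk_nhds hv₀) (Eventually.of_forall fun n => (h n).1)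
  · exact (isClosed_adjointGraph t).mem_of_tendsto
      (hv₀.prodMk_nhds (hfx.sub (hu₀.const_smul _))) (Eventually.of_forall fun n => (h n).2)

/-- The equation at `c / 2` reads `(c + t* t) u = x + (c / 2) u`. The solution map at `c` has norm
at most `1 / c`, so this is a fixed point problem for a `1/2`-contraction. -/
theorem exists_half [CompleteSpace X] (hc : 0 < c)
    (hs : ∀ x, ∃ u v, IsResolvent A t c x u v) (x : X) :
    ∃ u v, IsResolvent A t (c / 2) x u v := by
  choose R T hR using hs
  let f : X → X := fun u => R (x + ((c / 2 : ℝ) : ℂ) • u)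
  have hf : ContractingWith (1 / 2) f := by
    refine ⟨by rw [← NNReal.coe_lt_coe]; norm_num, LipschitzWith.of_dist_le_mul fun u u' => ?_⟩
    have := ((hR (x + ((c / 2 : ℝ) : ℂ) • u)).sub
      (hR (x + ((c / 2 : ℝ) : ℂ) • u'))).mul_norm_le hc.le
    rw [add_sub_add_left_eq_sub, ← smul_sub, norm_smul, Complex.norm_real,
      Real.norm_of_nonneg (by positivity)] at this
    rw [dist_eq_norm, dist_eq_norm]
    have h2 : ‖f u - f u'‖ ≤ 1 / 2 * ‖u - u'‖ := by
      refine le_of_mul_le_mul_left (this.trans_eq ?_) hc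
      ring
    simpa using h2
  obtain ⟨u, hu, -⟩ := hf.exists_fixedPoint 0 (edist_ne_top _ _)
  have h := hR (x + ((c / 2 : ℝ) : ℂ) • u)
  rw [show R (x + ((c / 2 : ℝ) : ℂ) • u) = u from hu] at h
  refine ⟨u, _, h.1, ?_⟩
  convert! h.2 using 2
  rw [add_sub_assoc, sub_eq_add_neg, ← sub_smul, ← neg_smul]
  congr 2
  push_cast
  ring

theorem exists_pow [CompleteSpace X] (hs : ∀ x, ∃ u v, IsResolvent A t 1 x u v) (n : ℕ) :
    ∀ x, ∃ u v, IsResolvent A t ((1 / 2) ^ n) x u v := by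
  induction n with
  | zero => simpa using hs
  | succ n ih =>
    intro x
    have := exists_half (by positivity) ih x
    rwa [pow_succ, mul_one_div]

end IsResolvent

/-! ### Closed range and the limit `c → 0`. -/

/-- The adjoint of a closed operator `t` with closed range is bounded below on the range of `t`. -/
theorem exists_norm_le_mul_norm_adjoint [CompleteSpace X] [CompleteSpace Y] {t : X →ₗ.[ℂ] Y}
    (ht : t.IsClosed) (hran : IsClosed (Set.range t)) :
    ∃ C > 0, ∀ w z, w ∈ Set.range t → (w, z) ∈ adjointGraph A t → ‖w‖ ≤ C * ‖z‖ := by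
  have : CompleteSpace t.graph := ht.completeSpace_coe
  have hr : IsClosed (LinearMap.range t.toFun : Set Y) := hran
  have : CompleteSpace (LinearMap.range t.toFun) := hr.completeSpace_coe
  -- The graph projects onto `Ran t`, both Banach spaces: open mapping gives preimages under `t` of
  -- controlled norm.
  let g : t.graph →L[ℂ] LinearMap.range t.toFun :=
    ((ContinuousLinearMap.snd ℂ X Y).comp t.graph.subtypeL).codRestrict _ fun p => by
      obtain ⟨x, -, hx⟩ := (LinearPMap.mem_graph_iff t).1 p.2
      exact ⟨x, hx⟩
  have hg : Function.Surjective g := by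
    rintro ⟨_, x, rfl⟩
    exact ⟨⟨_, LinearPMap.mem_graph t x⟩, rfl⟩
  obtain ⟨C, hC, h⟩ := g.exists_preimage_norm_le hg
  refine ⟨C, hC, fun w z hw hwz => ?_⟩
  obtain ⟨⟨⟨x, y⟩, hp⟩, hpw, hpn⟩ := h ⟨w, hw⟩
  obtain rfl : y = w := congrArg Subtype.val hpw
  have hx : ‖x‖ ≤ C * ‖y‖ := (norm_fst_le (x, y)).trans hpn
  -- Here `y = t x`, so `⟪y, y⟫ = ⟪x, t* y⟫`.
  have h1 : ‖y‖ ^ 2 ≤ ‖x‖ * ‖z‖ := by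
    rw [CStarModule.norm_sq_eq A, inner_of_mem_graph hp hwz]
    exact CStarModule.norm_inner_le X
  rcases eq_or_ne y 0 with rfl | hy
  · simpa using mul_nonneg hC.le (norm_nonneg z)
  · have hy' := norm_pos_iff.2 hy
    have h2 := mul_le_mul_of_nonneg_right hx (norm_nonneg z)
    nlinarith

theorem norm_le_of_sq_le {C a b e : ℝ} (hC : 0 < C) (he : 0 ≤ e)
    (hab : a ≤ C * b) (hb : b ^ 2 ≤ a * e) : b ≤ C * e := by
  have := mul_le_mul_of_nonneg_right hab he
  by_contra! hlt
  have hb0 : 0 < b := lt_of_le_of_lt (by positivity) hlt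
  nlinarith

theorem range_comp_adjoint [CompleteSpace X] [CompleteSpace Y] {t : X →ₗ.[ℂ] Y}
    (ht : IsRegular A t) (hran : IsClosed (Set.range t)) :
    Set.range (comp t (adjoint A t)) = Set.range t := by
  refine Set.Subset.antisymm ?_ ?_
  · rintro _ ⟨w, rfl⟩
    exact ⟨⟨_, w.2.2⟩, rfl⟩
  rintro y hy
  obtain ⟨x, hxy⟩ := LinearPMap.mem_range_iff.1 hy
  obtain ⟨C, hC, hbd⟩ := exists_norm_le_mul_norm_adjoint (A := A) ht.isClosed hran
  have hex := fun n => IsResolvent.exists_pow (IsResolvent.exists_one ht.isClosed ht.dense_domain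
    ht.dense_range_one_add) n x
  choose u v huv using hex
  let c : ℕ → ℝ := fun n => (1 / 2) ^ n
  let z : ℕ → X := fun n => x - (c n : ℂ) • u n
  have hc : ∀ n, 0 ≤ c n := fun n => by positivity
  have hcn : ∀ n, ‖(c n : ℂ)‖ = c n := fun n => by
    rw [Complex.norm_real, Real.norm_of_nonneg (hc n)]
  have hvz : ∀ n, (v n, z n) ∈ adjointGraph A t := fun n => (huv n).2
  -- Thus `t t* v = y - c v`.
  have hzt : ∀ n, (z n, y - (c n : ℂ) • v n) ∈ t.graph := fun n =>
    t.graph.sub_mem hxy (t.graph.smul_mem _ (huv n).1)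
  have hvr : ∀ n, v n ∈ LinearMap.range t.toFun := fun n =>
    LinearPMap.mem_range_iff.2 ⟨_, (huv n).1⟩
  -- Pairing `v` with `y = c v + t z` gives `‖z‖² ≤ ‖v‖ ‖y‖`, and `‖v‖ ≤ C ‖z‖` closes the estimate.
  have hz : ∀ n, ‖z n‖ ≤ C * ‖y‖ := fun n => by
    have h : (inner A (v n) y : A) =
        (c n : ℂ) • inner A (v n) (v n) + inner A (z n) (z n) := by
      have := congrArg star (inner_of_mem_graph (hzt n) (hvz n))
      rw [CStarModule.star_inner, CStarModule.star_inner, CStarModule.inner_sub_right,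
        CStarModule.inner_smul_right_complex] at this
      rw [← this]
      abel
    exact norm_le_of_sq_le hC (norm_nonneg _) (hbd _ _ (hvr n) (hvz n))
      (sq_norm_le_of_inner_eq (hc n) h).2
  set B := C * (C * ‖y‖) with hB
  have hv : ∀ n, ‖v n‖ ≤ B := fun n =>
    (hbd _ _ (hvr n) (hvz n)).trans (mul_le_mul_of_nonneg_left (hz n) hC.le)
  have hdv : ∀ n, ‖v n - v (n + 1)‖ ≤ C * ‖z n - z (n + 1)‖ := fun n =>
    hbd _ _ ((LinearMap.range t.toFun).sub_mem (hvr n) (hvr (n + 1)))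
      ((adjointGraph A t).sub_mem (hvz n) (hvz (n + 1)))
  -- The same argument for differences: `t` sends `z n - z (n + 1)` to `c (n + 1) v (n + 1) - c n v
  -- n`, of norm at most `2 B c n`.
  have hdz : ∀ n, ‖z n - z (n + 1)‖ ≤ C * (2 * B) * (1 / 2) ^ n := fun n => by
    have h := inner_of_mem_graph (t.graph.sub_mem (hzt n) (hzt (n + 1)))
      ((adjointGraph A t).sub_mem (hvz n) (hvz (n + 1)))
    have h1 := norm_le_of_sq_le hC (norm_nonneg _) (hdv n)
      (e := ‖(y - (c n : ℂ) • v n) - (y - (c (n + 1) : ℂ) • v (n + 1))‖) (by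
        rw [CStarModule.norm_sq_eq A, ← h, mul_comm]
        exact CStarModule.norm_inner_le Y)
    refine h1.trans ?_
    rw [mul_assoc]
    refine mul_le_mul_of_nonneg_left ?_ hC.le
    rw [sub_sub_sub_cancel_left]
    refine (norm_sub_le _ _).trans ?_
    rw [norm_smul, norm_smul, hcn, hcn]
    have h2 := mul_le_mul_of_nonneg_left (hv n) (hc n)
    have h3 := mul_le_mul_of_nonneg_left (hv (n + 1)) (hc (n + 1))
    have h4 : c (n + 1) = c n / 2 := by simp only [c, pow_succ]; ring
    have hB0 : 0 ≤ c n * B := mul_nonneg (hc n) ((norm_nonneg _).trans (hv n))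
    have h5 : c n = (1 / 2) ^ n := rfl
    rw [← h5]
    rw [h4] at h3 ⊢
    linarith
  have hcz : CauchySeq z := cauchySeq_of_le_geometric (1 / 2) (C * (2 * B)) (by norm_num)
    fun n => by rw [dist_eq_norm]; exact hdz n
  have hcv : CauchySeq v := cauchySeq_of_le_geometric (1 / 2) (C * (C * (2 * B))) (by norm_num)
    fun n => by
      rw [dist_eq_norm, mul_assoc]
      exact (hdv n).trans (mul_le_mul_of_nonneg_left (hdz n) hC.le)
  obtain ⟨z₀, hz₀⟩ := cauchySeq_tendsto_of_complete hcz
  obtain ⟨v₀, hv₀⟩ := cauchySeq_tendsto_of_complete hcv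
  have hc0 : Tendsto (fun n => (c n : ℂ)) atTop (𝓝 0) := by
    have : Tendsto c atTop (𝓝 0) :=
      tendsto_pow_atTop_nhds_zero_of_lt_one (by norm_num) (by norm_num)
    exact_mod_cast (Complex.continuous_ofReal.tendsto 0).comp this
  have hlim : Tendsto (fun n => y - (c n : ℂ) • v n) atTop (𝓝 y) := by
    simpa using tendsto_const_nhds.sub (hc0.smul hv₀)
  refine LinearPMap.mem_range_iff.2 ⟨v₀, mem_graph_comp.2 ⟨z₀, ?_, ?_⟩⟩
  · rw [graph_adjoint ht.dense_domain]
    exact (isClosed_adjointGraph t).mem_of_tendsto (hv₀.prodMk_nhds hz₀)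
      (Eventually.of_forall hvz)
  · exact ht.isClosed.mem_of_tendsto (hz₀.prodMk_nhds hlim) (Eventually.of_forall hzt)

end Hilbert

end HilbertModule

theorem lemma2p1 {A X Y : Type*}
    [NonUnitalCStarAlgebra A] [PartialOrder A] [StarOrderedRing A]
    [NormedAddCommGroup X] [NormedSpace ℂ X] [SMul A X] [CStarModule A X] [CompleteSpace X]
    [NormedAddCommGroup Y] [NormedSpace ℂ Y] [SMul A Y] [CStarModule A Y] [CompleteSpace Y]
    (t : X →ₗ.[ℂ] Y) (ht : HilbertModule.IsRegular A t) (hran : IsClosed (Set.range t)) :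
    IsClosed (Set.range (HilbertModule.comp t (HilbertModule.adjoint A t))) ∧
      Set.range (HilbertModule.comp t (HilbertModule.adjoint A t)) = Set.range t := by
  rw [HilbertModule.range_comp_adjoint ht hran]
  exact ⟨hran, rfl⟩
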